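/- All Hilbert spaces are finite-dimensional; a sub-normalized state is a positive semidefinite operator of trace at most $1$ (a normalized state has trace $1$), and logarithms are to base $2$. Let $\mathcal H_A$ be an $n$-qubit space with bit basis $|z\rangle$ and phase basis $|\widetilde x\rangle=2^{-n/2}\sum_{z}(-1)^{x\cdot z}|z\rangle$, $x,z\in\{0,1\}^n$. **Definitions.** * The conditional min-entropy $H_{\min}(\rho_{AE}|E)$ is the largest real $\lambda$ with $2^{-\lambda}\,\mathbb I_A\otimes\sigma_E\ge\rho_{AE}$ for some normalized state $\sigma_E$ (it is $+\infty$ if $\rho_{AE}=0$). The smooth one, $H^{\varepsilon}_{\min}(\rho_{AE}|E)$, is the largest $H_{\min}(\bar\rho_{AE}|E)$ over sub-normalized $\bar\rho_{AE}$ with $P(\bar\rho_{AE},\rho_{AE})\le\varepsilon$, where $P=\sqrt{1-F^2}$ and $F(\rho,\tau)=\|\sqrt\rho\sqrt\tau\|_1+\sqrt{(1-\mathrm{Tr}\rho)(1-\mathrm{Tr}\tau)}$. * The Rényi entropy of degree $1/2$ of a (sub-normalized) distribution is $H_{1/2}(X)=2\log\sum_x\Pr(X=x)^{1/2}$ ($-\infty$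 if the distribution is zero). * A pure sub-normalized state $|\Phi\rangle_{AE\bar A}$ is a semi-purification of $\rho_{AE}$ if $\rho_{AE}=\sum_z|z\rangle\langle z|_A\,\mathrm{Tr}_{\bar A}(|\Phi\rangle\langle\Phi|)\,|z\rangle\langle z|_A$. Its phase distribution is $\Pr(X=x)=\langle\widetilde x|\Phi_A|\widetilde x\rangle$, where $\Phi_A=\mathrm{Tr}_{E\bar A}|\Phi\rangle\langle\Phi|$. * Actual QKD scheme: Alice, Eve and Bob hold a normalized state $\rho^{\rm ini}_{A'EB'}$. A sample measurement is made, its public announcements being written into $\mathcal H_E$, and the protocol continues only on a set of accepted outcomes. Then Alice measures $\mathcal H_{A'}$ and Bob measures $\mathcal H_{B'}$ to obtain sifted keys $a,b\in\{0,1\}^n$, stored in the bit basis. The resulting sub-normalized state, reduced to Alice's key and Eve's system, is $\rho^{\rm sif}_{AE}$. * Virtual scheme: $\rho^{\rm ini}$ is replaced by a purification. The sample measurement with outcome "continue" is rewritten as a unitary followed by a projection on a fresh ancilla. Alice's sifted-key measurement is rewritten as a unitary $U^{\rm sif}$ on $\mathcal H_A$ (initially $|0\rangle$) and $\mathcal H_{\bar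 A}$ followed by the bit-basis measurement of $\mathcal H_A$. Here $\mathcal H_{\bar A}$ collects all systems other than $\mathcal H_A$ and $\mathcal H_E$. The pure sub-normalized state after $U^{\rm sif}$, just before the bit-basis measurement, is $|\Psi^{\rm pre}\rangle_{AE\bar A}$. **Lemma.** Let $H^{\rm th}_{1/2}\in\mathbb R$. 1. For every actual scheme and every associated virtual scheme: if the phase distribution $X$ of $|\Psi^{\rm pre}\rangle$ satisfies $H_{1/2}(X)\le H_{1/2}^{\rm th}$ (assumption SM-PEC-Rényi), then $$H_{\min}(\rho^{\rm sif}_{AE}|E)\ \ge\ n-H^{\rm th}_{1/2}.$$ Moreover $H^{0}_{\min}(\rho^{\rm sif}_{AE}|E)\ge n-H^{\rm th}_{1/2}$, so that the scheme is of LHL type: it satisfies the assumption SM-LHL, $H^{\varepsilon}_{\min}(\rho^{\rm sif}_{AE}|E)\ge H^{\rm th}_{\min}$, with $\varepsilon=0$ and $H_{\min}^{\rm th}=n-H^{\rm th}_{1/2}$. 2. More generally, both inequalities hold for every sub-normalized classical-quantum state $\rho_{AE}$, with $\mathcal H_E\neq 0$, that has a semi-purification $|\Phi\rangle_{AE\bar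 A}$ whose phase distribution satisfies $H_{1/2}(X)\le H_{1/2}^{\rm th}$. -/

import Mathlib

open scoped Kronecker ComplexOrder MatrixOrder

noncomputable section

namespace QKD

/-- Bit strings of length `n`; this type indexes the bit basis of an `n`-qubit space. -/
abbrev BitString (n : ℕ) : Type := Fin n → ZMod 2

/-- Partial trace over the second tensor factor. -/
def ptrace {α β : Type*} [Fintype β] (M : Matrix (α × β) (α × β) ℂ) : Matrix α α ℂ :=
  Matrix.of fun i j => ∑ k, M (i, k) (j, k)

/-- The rank-one operator `|ψ⟩⟨ψ|`. -/
def pureOp {α : Type*} (ψ : α → ℂ) : Matrix α α ℂ :=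
  Matrix.vecMulVec ψ (star ψ)

/-- A sub-normalized state: a positive semidefinite operator of trace at most one. -/
def IsSubnormalized {α : Type*} [Fintype α] (ρ : Matrix α α ℂ) : Prop :=
  ρ.PosSemidef ∧ ρ.trace.re ≤ 1

/-- A normalized state: a positive semidefinite operator of trace one. -/
def IsNormalized {α : Type*} [Fintype α] (ρ : Matrix α α ℂ) : Prop :=
  ρ.PosSemidef ∧ ρ.trace = 1

/-! ### Entropies -/

/-- The conditional min-entropy `H_min(ρ_AE | E)`: the largest real `l` with
`2 ^ (-l) • (1_A ⊗ σ_E) ≥ ρ_AE` for some normalized state `σ_E`.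
It is extended-real valued, because all real `l` are admissible when `ρ_AE = 0`. -/
def condMinEntropy {α ε : Type*} [Fintype α] [DecidableEq α] [Fintype ε]
    (ρ : Matrix (α × ε) (α × ε) ℂ) : EReal :=
  sSup {h : EReal | ∃ l : ℝ, h = (l : EReal) ∧ ∃ σ : Matrix ε ε ℂ, IsNormalized σ ∧
    (((2 : ℝ) ^ (-l)) • ((1 : Matrix α α ℂ) ⊗ₖ σ) - ρ).PosSemidef}

/-- The 1-norm `‖M‖₁ = Tr √(M† M)`. -/
def norm1 {α : Type*} [Fintype α] [DecidableEq α] (M : Matrix α α ℂ) : ℝ :=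
  (CFC.sqrt (M.conjTranspose * M)).trace.re

/-- The generalized fidelity of sub-normalized states,
`F(ρ, τ) = ‖√ρ √τ‖₁ + √((1 - Tr ρ) (1 - Tr τ))`. -/
def fidelity {α : Type*} [Fintype α] [DecidableEq α] (ρ τ : Matrix α α ℂ) : ℝ :=
  norm1 (CFC.sqrt ρ * CFC.sqrt τ) + Real.sqrt ((1 - ρ.trace.re) * (1 - τ.trace.re))

/-- The purified distance `P(ρ, τ) = √(1 - F(ρ, τ) ^ 2)`. -/
def purifiedDistance {α : Type*} [Fintype α] [DecidableEq α] (ρ τ : Matrix α α ℂ) : ℝ :=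
  Real.sqrt (1 - fidelity ρ τ ^ 2)

/-- The smooth conditional min-entropy `H_min^δ(ρ_AE | E)`: the largest conditional min-entropy
of a sub-normalized state within purified distance `δ` of `ρ_AE`. -/
def smoothCondMinEntropy {α ε : Type*} [Fintype α] [DecidableEq α] [Fintype ε] [DecidableEq ε]
    (δ : ℝ) (ρ : Matrix (α × ε) (α × ε) ℂ) : EReal :=
  sSup {h : EReal | ∃ τ : Matrix (α × ε) (α × ε) ℂ,
    h = condMinEntropy τ ∧ IsSubnormalized τ ∧ purifiedDistance τ ρ ≤ δ}

/-- The Rényi entropy of degree `1/2`, in bits: `H_{1/2}(X) = 2 log₂ ∑ₓ Pr(X = x) ^ (1/2)`.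
It is `-∞` for the zero sub-distribution. -/
def renyiHalf {χ : Type*} [Fintype χ] (p : χ → ℝ) : EReal :=
  if ∑ x, Real.sqrt (p x) = 0 then ⊥
  else ((2 * Real.logb 2 (∑ x, Real.sqrt (p x)) : ℝ) : EReal)

/-! ### Bit basis, phase basis, semi-purifications -/

/-- The phase-basis vector `|x̃⟩ = 2 ^ (-n/2) ∑_z (-1) ^ (x · z) |z⟩`. -/
def phaseKet {n : ℕ} (x : BitString n) : BitString n → ℂ :=
  fun z => (((2 : ℝ) ^ (-(n : ℝ) / 2) : ℝ) : ℂ) * (-1) ^ (x ⬝ᵥ z).val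

/-- The distribution of the phase degrees of freedom of a vector in `H_A ⊗ H_E ⊗ H_Ā`:
`Pr(X = x) = ⟨x̃| ρ_A |x̃⟩`, where `ρ_A` is the reduced state on the `n`-qubit space `H_A`. -/
def phaseDist {n : ℕ} {ε κ : Type*} [Fintype ε] [Fintype κ]
    (Ψ : (BitString n × ε) × κ → ℂ) (x : BitString n) : ℝ :=
  (star (phaseKet x) ⬝ᵥ (ptrace (ptrace (pureOp Ψ))).mulVec (phaseKet x)).re

/-- The `Z`-basis measurement of `H_A`, without selecting the outcome:
`ρ_AE ↦ ∑_z |z⟩⟨z|_A ρ_AE |z⟩⟨z|_A`. -/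
def zMeasure {n : ℕ} {ε : Type*} [Fintype ε] [DecidableEq ε]
    (ρ : Matrix (BitString n × ε) (BitString n × ε) ℂ) :
    Matrix (BitString n × ε) (BitString n × ε) ℂ :=
  ∑ z : BitString n,
    (Matrix.single z z (1 : ℂ) ⊗ₖ (1 : Matrix ε ε ℂ)) * ρ *
      (Matrix.single z z (1 : ℂ) ⊗ₖ (1 : Matrix ε ε ℂ))

/-- The pure sub-normalized state `Φ` in `H_A ⊗ H_E ⊗ H_Ā` is a semi-purification of `ρ_AE`:
its reduced state on `H_A ⊗ H_E` becomes `ρ_AE` after the `Z`-basis measurement of `H_A`. -/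
def IsSemiPurification {n : ℕ} {ε κ : Type*} [Fintype ε] [DecidableEq ε] [Fintype κ]
    (Φ : (BitString n × ε) × κ → ℂ)
    (ρ : Matrix (BitString n × ε) (BitString n × ε) ℂ) : Prop :=
  IsSubnormalized (pureOp Φ) ∧ zMeasure (ptrace (pureOp Φ)) = ρ

/-! ### The actual scheme, up to the sifted key -/

/-- The part of a quantum key distribution scheme which determines the sifted key.
`A` and `B` index the spaces measured by Alice and by Bob, `E` that of Eve, and `I` the outcomes
of the sample measurement. -/
structure ActualScheme (n : ℕ) (A E B I : Type*) [Fintype A] [DecidableEq A]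
    [Fintype E] [DecidableEq E] [Fintype B] [DecidableEq B] [Fintype I] where
  /-- the initial mixed state -/
  init : Matrix (A × E × B) (A × E × B) ℂ
  init_normalized : IsNormalized init
  /-- The measurement operators of the sample measurement. They may act on `E`, since
  public announcements are written there. -/
  smp : I → Matrix (A × E × B) (A × E × B) ℂ
  smp_complete : ∑ i, (smp i).conjTranspose * smp i = 1
  /-- the outcomes of the sample measurement on which the protocol is continued -/
  pass : Finset I
  /-- the measurement operators by which Alice obtains her sifted key -/
  sifA : BitString n → Matrix A A ℂ
  sifA_complete : ∑ a, (sifA a).conjTranspose * sifA a = 1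
  /-- the measurement operators by which Bob obtains his sifted key -/
  sifB : BitString n → Matrix B B ℂ
  sifB_complete : ∑ b, (sifB b).conjTranspose * sifB b = 1

section Schemes

variable {n : ℕ} {A E B I C R : Type*} [Fintype A] [DecidableEq A] [Fintype E] [DecidableEq E]
  [Fintype B] [DecidableEq B] [Fintype I] [Fintype C] [DecidableEq C] [Fintype R] [DecidableEq R]

/-- The effect of the sample measurement when the protocol is continued (not normalized). -/
def ActualScheme.sample (S : ActualScheme n A E B I)
    (ρ : Matrix (A × E × B) (A × E × B) ℂ) : Matrix (A × E × B) (A × E × B) ℂ :=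
  ∑ i ∈ S.pass, S.smp i * ρ * (S.smp i).conjTranspose

/-- The sub-normalized state after the sifted key measurement, on
(Alice's key) ⊗ (Bob's key) ⊗ (measured systems of Alice, Eve and Bob). -/
def ActualScheme.sifted (S : ActualScheme n A E B I) :
    Matrix (BitString n × BitString n × A × E × B) (BitString n × BitString n × A × E × B) ℂ :=
  ∑ a : BitString n, ∑ b : BitString n,
    Matrix.single a a (1 : ℂ) ⊗ₖ (Matrix.single b b (1 : ℂ) ⊗ₖ
      ((S.sifA a ⊗ₖ ((1 : Matrix E E ℂ) ⊗ₖ S.sifB b)) * S.sample S.init *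
        (S.sifA a ⊗ₖ ((1 : Matrix E E ℂ) ⊗ₖ S.sifB b)).conjTranspose))

/-- The reduced sub-normalized sifted-key state of Alice's key and Eve's system. -/
def ActualScheme.siftedAE (S : ActualScheme n A E B I) :
    Matrix (BitString n × E) (BitString n × E) ℂ :=
  Matrix.of fun x y => ∑ b : BitString n, ∑ a' : A, ∑ b' : B,
    S.sifted (x.1, b, a', x.2, b') (y.1, b, a', y.2, b')

/-! ### The purified (virtual) scheme, up to the sifted key -/

/-- The data of the virtual scheme obtained from an actual scheme by purifying its initial state
with a space indexed by `C`, and by rewriting each measurement as a unitary operation, with a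
further ancilla indexed by `R`, followed by a projective measurement. All the systems except those
indexed by `BitString n` and by `E` form Alice's ancilla, which is indexed by `A × B × R × C`. -/
structure VirtualScheme (S : ActualScheme n A E B I) (C R : Type*) [Fintype C] [DecidableEq C]
    [Fintype R] [DecidableEq R] where
  /-- a purification of the initial state -/
  ini : (A × E × B) × C → ℂ
  ini_purifies : ptrace (pureOp ini) = S.init
  /-- the initial basis state of the ancilla `R` -/
  blank : R
  /-- the unitary operation and the projection which replace the sample measurement -/
  uSmp : Matrix ((A × E × B) × R) ((A × E × B) × R) ℂ
  uSmp_unitary : uSmp ∈ Matrix.unitaryGroup ((A × E × B) × R) ℂ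
  pSmp : Matrix R R ℂ
  pSmp_proj : pSmp.IsHermitian ∧ pSmp * pSmp = pSmp
  /-- Unitary and projection have the effect of the sample measurement with outcome `continue`. -/
  smp_eq : ∀ ρ : Matrix (A × E × B) (A × E × B) ℂ,
    ptrace ((((1 : Matrix (A × E × B) (A × E × B) ℂ) ⊗ₖ pSmp) * uSmp) *
      (ρ ⊗ₖ Matrix.single blank blank (1 : ℂ)) *
      (((1 : Matrix (A × E × B) (A × E × B) ℂ) ⊗ₖ pSmp) * uSmp).conjTranspose) = S.sample ρ
  /-- The unitary operation which, acting on the `n`-qubit space in the state `|0⟩` and on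
  Alice's ancilla, and followed by the `Z`-basis measurement, replaces the measurement of Alice's
  sifted key. -/
  uSif : Matrix (BitString n × A × B × R × C) (BitString n × A × B × R × C) ℂ
  uSif_unitary : uSif ∈ Matrix.unitaryGroup (BitString n × A × B × R × C) ℂ
  /-- The outcomes `a` have the same probabilities, in every state, as in Alice's measurement:
  the two measurements have the same positive operators. -/
  sif_eq : ∀ a : BitString n,
    (uSif.submatrix (fun k => (a, k)) (fun k => (0, k))).conjTranspose *
      uSif.submatrix (fun k => (a, k)) (fun k => (0, k)) =
    ((S.sifA a).conjTranspose * S.sifA a) ⊗ₖ (1 : Matrix (B × R × C) (B × R × C) ℂ)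

/-- The pure sub-normalized state after the sample measurement of the virtual scheme:
`P U (|ini⟩ ⊗ |blank⟩)`. -/
def VirtualScheme.smpState {S : ActualScheme n A E B I} (V : VirtualScheme S C R) :
    ((A × E × B) × R) × C → ℂ :=
  fun y => ∑ x : A × E × B,
    (((1 : Matrix (A × E × B) (A × E × B) ℂ) ⊗ₖ V.pSmp) * V.uSmp) y.1 (x, V.blank) *
      V.ini (x, y.2)

/-- The pure sub-normalized state after the sifted key state preparation of the virtual scheme,
just before the `Z`-basis measurement: the unitary `uSif` applied to `|0⟩ ⊗ |smpState⟩`. -/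
def VirtualScheme.preState {S : ActualScheme n A E B I} (V : VirtualScheme S C R) :
    (BitString n × E) × (A × B × R × C) → ℂ :=
  fun y => ∑ k : A × B × R × C,
    V.uSif (y.1.1, y.2) (0, k) * V.smpState (((k.1, y.1.2, k.2.1), k.2.2.1), k.2.2.2)

end Schemes

/-! ### The two assumptions -/

/-- The assumption of the phase-error-correction approach in terms of the Rényi entropy:
the phase distribution `X` of the state satisfies `H_{1/2}(X) ≤ Hth`. -/
def AssumptionSMPECRenyi {n : ℕ} {ε κ : Type*} [Fintype ε] [Fintype κ]
    (Ψ : (BitString n × ε) × κ → ℂ) (Hth : ℝ) : Prop :=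
  renyiHalf (phaseDist Ψ) ≤ (Hth : EReal)

/-- The assumption of the leftover-hashing approach: `H_min^δ(ρ_AE | E) ≥ Hth`. -/
def AssumptionSMLHL {n : ℕ} {ε : Type*} [Fintype ε] [DecidableEq ε]
    (ρ : Matrix (BitString n × ε) (BitString n × ε) ℂ) (δ Hth : ℝ) : Prop :=
  (Hth : EReal) ≤ smoothCondMinEntropy δ ρ

end QKD

end

/-!
Read a vector `Φ` of `H_A ⊗ H_E ⊗ H_Ā` as the family of its components `⟨z|Φ`, operators from
`H_Ā` to `H_E`. In terms of the phase components `N_x = ⟨x̃|Φ`, they are `⟨z|Φ = ∑ₓ φ_x(z) N_x` with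
`|φ_x(z)|² = 2⁻ⁿ` and `‖N_x‖₂² = Pr(X = x)`. The Cauchy–Schwarz inequality in the Loewner order,
with weights `Pr(X = x)^(1/2)`, bounds each block `⟨z|Φ (⟨z|Φ)†` of the measured state by
`2⁻ⁿ (∑ₓ Pr(X = x)^(1/2))² σ`, where the normalized state `σ` does not depend on `z`; the scalar is
`2 ^ (H_{1/2}(X) - n)`. The virtual state is a semi-purification of the sifted-key state because the
reduced state of Alice's key and Eve depends on the sifted-key measurements only through Alice's
effects, on which the two schemes agree.
-/

noncomputable section

namespace QKD

open Matrix

section CauchySchwarz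

variable {ι m n 𝕜 : Type*} [Fintype ι] [Finite m] [Fintype n] [RCLike 𝕜]

lemma sum_smul_mul_conjTranspose_le (c : ι → 𝕜) (M : ι → Matrix m n 𝕜) :
    (∑ x, c x • M x) * (∑ x, c x • M x)ᴴ ≤ (∑ x, ‖c x‖ ^ 2) • ∑ x, M x * (M x)ᴴ := by
  set W := ∑ x, c x • M x with hW
  set C := ∑ x, ‖c x‖ ^ 2 with hC
  have residual (x : ι) : (C • M x - star (c x) • W) * (C • M x - star (c x) • W)ᴴ =
      C ^ 2 • (M x * (M x)ᴴ) - C • (c x • M x * Wᴴ) - C • (W * (c x • M x)ᴴ) +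
        ‖c x‖ ^ 2 • (W * Wᴴ) := by
    have h_norm : ‖c x‖ ^ 2 • (W * Wᴴ) = (star (c x) * c x) • (W * Wᴴ) := by
      rw [RCLike.star_def, RCLike.conj_mul, ← RCLike.ofReal_pow,
        RCLike.real_smul_eq_coe_smul (K := 𝕜)]
    rw [h_norm]
    simp only [conjTranspose_sub, conjTranspose_smul, star_star, star_trivial, Matrix.sub_mul,
      Matrix.mul_sub, Matrix.smul_mul, Matrix.mul_smul]
    module
  have sum_residual : ∑ x, (C • M x - star (c x) • W) * (C • M x - star (c x) • W)ᴴ =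
      C • (C • ∑ x, M x * (M x)ᴴ - W * Wᴴ) := by
    simp_rw [residual, Finset.sum_add_distrib, Finset.sum_sub_distrib, ← Finset.smul_sum,
      ← Finset.sum_smul, ← Matrix.sum_mul, ← Matrix.mul_sum, ← conjTranspose_sum, ← hW, ← hC]
    module
  have hC_nonneg : 0 ≤ C := Finset.sum_nonneg fun x _ => sq_nonneg ‖c x‖
  rcases hC_nonneg.eq_or_lt' with h | h
  · have hc (x : ι) : c x = 0 := by
      simpa using (Finset.sum_eq_zero_iff_of_nonneg fun x _ => sq_nonneg ‖c x‖).1 h x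
    simp [hW, hC, hc]
  · have h_smul : (C • (C • ∑ x, M x * (M x)ᴴ - W * Wᴴ)).PosSemidef := by
      rw [← sum_residual]
      exact posSemidef_sum _ fun x _ => posSemidef_self_mul_conjTranspose _
    rw [le_iff, ← inv_smul_smul₀ h.ne' (_ - _)]
    exact h_smul.smul (inv_nonneg.2 h.le)

lemma sum_smul_mul_conjTranspose_le_of_weight (c : ι → 𝕜) (M : ι → Matrix m n 𝕜) {w : ι → ℝ}
    (hw : ∀ x, 0 ≤ w x) (hM : ∀ x, w x = 0 → M x = 0) :
    (∑ x, c x • M x) * (∑ x, c x • M x)ᴴ ≤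
      (∑ x, ‖c x‖ ^ 2 * w x) • ∑ x, (w x)⁻¹ • (M x * (M x)ᴴ) := by
  have rescaled := sum_smul_mul_conjTranspose_le (fun x => √(w x) • c x) (fun x => (√(w x))⁻¹ • M x)
  have rescale (x : ι) : (√(w x) • c x) • (√(w x))⁻¹ • M x = c x • M x := by
    by_cases h : w x = 0
    · simp [hM x h]
    · have : √(w x) ≠ 0 := (Real.sqrt_ne_zero (hw x)).2 h
      rw [smul_comm, smul_assoc, inv_smul_smul₀ this]
  have weight (x : ι) : ‖√(w x) • c x‖ ^ 2 = ‖c x‖ ^ 2 * w x := by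
    rw [norm_smul, mul_pow, Real.norm_of_nonneg (Real.sqrt_nonneg _), Real.sq_sqrt (hw x), mul_comm]
  have term (x : ι) :
      ((√(w x))⁻¹ • M x) * ((√(w x))⁻¹ • M x)ᴴ = (w x)⁻¹ • (M x * (M x)ᴴ) := by
    rw [conjTranspose_smul, star_trivial, Matrix.smul_mul, Matrix.mul_smul, smul_smul, ← mul_inv,
      Real.mul_self_sqrt (hw x)]
  simpa only [rescale, weight, term] using rescaled

end CauchySchwarz

section States

variable {α β : Type*} [Fintype α] [Fintype β]

omit [Fintype α] in
lemma ptrace_pureOp (ψ : α × β → ℂ) :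
    ptrace (pureOp ψ) = (of fun x k => ψ (x, k)) * (of fun x k => ψ (x, k))ᴴ := by
  ext i j
  simp [ptrace, pureOp, vecMulVec_apply, mul_apply]

lemma trace_ptrace (M : Matrix (α × β) (α × β) ℂ) : (ptrace M).trace = M.trace := by
  simp [trace, ptrace, Fintype.sum_prod_type]

lemma trace_kronecker_one_mul [DecidableEq β] (P : Matrix α α ℂ) (M : Matrix (α × β) (α × β) ℂ) :
    ((P ⊗ₖ (1 : Matrix β β ℂ)) * M).trace = (P * ptrace M).trace := by
  simp only [trace, diag_apply, mul_apply, Fintype.sum_prod_type, kroneckerMap_apply, one_apply,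
    mul_ite, mul_one, mul_zero, ite_mul, zero_mul, Finset.sum_ite_eq, Finset.mem_univ, if_true,
    ptrace, of_apply, Finset.mul_sum]
  exact Finset.sum_congr rfl fun a _ => Finset.sum_comm

omit [Fintype α] in
lemma posSemidef_ptrace {M : Matrix (α × β) (α × β) ℂ} (hM : M.PosSemidef) :
    (ptrace M).PosSemidef := by
  have h : ptrace M = ∑ k, M.submatrix (fun i => (i, k)) (fun i => (i, k)) := by
    ext i j
    simp [ptrace, Matrix.sum_apply]
  rw [h]
  exact posSemidef_sum _ fun k _ => hM.submatrix _

lemma IsSubnormalized.ptrace {M : Matrix (α × β) (α × β) ℂ} (hM : IsSubnormalized M) :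
    IsSubnormalized (ptrace M) :=
  ⟨posSemidef_ptrace hM.1, by rw [trace_ptrace]; exact hM.2⟩

omit [Fintype α] in
lemma posSemidef_single_one [DecidableEq α] (a : α) : (single a a (1 : ℂ)).PosSemidef := by
  rw [← diagonal_single]
  exact .diagonal (Pi.single_nonneg.2 zero_le_one)

lemma mul_kronecker_single_mul_conjTranspose {γ : Type*} [DecidableEq β]
    (Q : Matrix γ (α × β) ℂ) (ρ : Matrix α α ℂ) (b : β) :
    Q * (ρ ⊗ₖ single b b (1 : ℂ)) * Qᴴ =
      Q.submatrix id (fun x => (x, b)) * ρ * (Q.submatrix id fun x => (x, b))ᴴ := by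
  ext i j
  simp [mul_apply, Fintype.sum_prod_type, single_apply, ite_and, Finset.sum_mul]

lemma exists_isNormalized [Nonempty α] : ∃ σ : Matrix α α ℂ, IsNormalized σ := by
  classical
  obtain ⟨a⟩ := ‹Nonempty α›
  exact ⟨single a a 1, posSemidef_single_one a, by simp⟩

lemma fidelity_self [DecidableEq α] {ρ : Matrix α α ℂ} (h : IsSubnormalized ρ) :
    fidelity ρ ρ = 1 := by
  have h_sqrt : CFC.sqrt (ρᴴ * ρ) = ρ := by
    rw [h.1.isHermitian.eq, CFC.sqrt_mul_self ρ h.1.nonneg]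
  rw [fidelity, norm1, CFC.sqrt_mul_sqrt_self ρ h.1.nonneg, h_sqrt,
    Real.sqrt_mul_self (sub_nonneg.2 h.2), add_sub_cancel]

lemma condMinEntropy_le_smoothCondMinEntropy [DecidableEq α] [DecidableEq β]
    {ρ : Matrix (α × β) (α × β) ℂ} (h : IsSubnormalized ρ) {δ : ℝ} (hδ : 0 ≤ δ) :
    condMinEntropy ρ ≤ smoothCondMinEntropy δ ρ :=
  le_sSup ⟨ρ, rfl, h, by simpa [purifiedDistance, fidelity_self h] using hδ⟩

lemma renyiHalf_le_iff {p : α → ℝ} {h : ℝ} :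
    renyiHalf p ≤ h ↔ (∑ x, √(p x)) ^ 2 ≤ (2 : ℝ) ^ h := by
  unfold renyiHalf
  split_ifs with hs
  · simpa [hs] using Real.rpow_nonneg zero_le_two h
  · have hpos : 0 < (∑ x, √(p x)) ^ 2 := by positivity
    rw [EReal.coe_le_coe_iff, ← Real.logb_le_iff_le_rpow one_lt_two hpos, Real.logb_pow,
      Nat.cast_ofNat]

end States

section ClassicalQuantum

variable {α ε : Type*} [Fintype α] [DecidableEq α]

/-- The classical-quantum operator `∑_z |z⟩⟨z| ⊗ ρ_z`. -/
def cqState (ρ : α → Matrix ε ε ℂ) : Matrix (α × ε) (α × ε) ℂ :=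
  ∑ z, single z z (1 : ℂ) ⊗ₖ ρ z

lemma cqState_apply (ρ : α → Matrix ε ε ℂ) (i j : α × ε) :
    cqState ρ i j = if i.1 = j.1 then ρ i.1 i.2 j.2 else 0 := by
  simp only [cqState, Matrix.sum_apply, kroneckerMap_apply, single_apply, ite_mul, one_mul,
    zero_mul]
  split_ifs with h
  · simp [h]
  · exact Finset.sum_eq_zero fun z _ => if_neg fun hz => h (hz.1.symm.trans hz.2)

lemma one_kronecker_eq_cqState (σ : Matrix ε ε ℂ) :
    (1 : Matrix α α ℂ) ⊗ₖ σ = cqState fun _ => σ := by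
  ext i j
  simp [cqState_apply, one_apply]

lemma cqState_sub (ρ τ : α → Matrix ε ε ℂ) : cqState ρ - cqState τ = cqState (ρ - τ) := by
  ext i j
  simp only [Matrix.sub_apply, cqState_apply, Pi.sub_apply]
  split_ifs <;> simp

lemma posSemidef_cqState [Finite ε] {ρ : α → Matrix ε ε ℂ} (hρ : ∀ z, (ρ z).PosSemidef) :
    (cqState ρ).PosSemidef :=
  posSemidef_sum _ fun z _ => (posSemidef_single_one z).kronecker (hρ z)

variable [Fintype ε]

lemma trace_cqState (ρ : α → Matrix ε ε ℂ) : (cqState ρ).trace = ∑ z, (ρ z).trace := by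
  simp [cqState, trace_sum, trace_kronecker]

lemma le_condMinEntropy_cqState {ρ : α → Matrix ε ε ℂ} {σ : Matrix ε ε ℂ} (hσ : IsNormalized σ)
    {l : ℝ} (h : ∀ z, ρ z ≤ (2 : ℝ) ^ (-l) • σ) : (l : EReal) ≤ condMinEntropy (cqState ρ) := by
  refine le_sSup ⟨l, rfl, σ, hσ, ?_⟩
  rw [← kronecker_smul, one_kronecker_eq_cqState, cqState_sub]
  exact posSemidef_cqState h

variable {n : ℕ} [DecidableEq ε]

lemma zMeasure_eq_cqState (ρ : Matrix (BitString n × ε) (BitString n × ε) ℂ) :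
    zMeasure ρ = cqState fun z => ρ.submatrix (Prod.mk z) (Prod.mk z) := by
  have h_proj (z : BitString n) : single z z (1 : ℂ) ⊗ₖ (1 : Matrix ε ε ℂ) =
      diagonal fun p => if p.1 = z then 1 else 0 := by
    rw [← diagonal_single, ← diagonal_one, diagonal_kronecker_diagonal]
    congr with p
    simp [Pi.single_apply]
  ext ⟨z, e⟩ ⟨z', e'⟩
  by_cases h : z = z' <;>
    simp [zMeasure, h_proj, cqState_apply, Matrix.sum_apply, mul_diagonal, diagonal_mul, h]

lemma trace_zMeasure (ρ : Matrix (BitString n × ε) (BitString n × ε) ℂ) :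
    (zMeasure ρ).trace = ρ.trace := by
  simp [zMeasure_eq_cqState, cqState_apply, trace, Fintype.sum_prod_type]

lemma IsSubnormalized.zMeasure {ρ : Matrix (BitString n × ε) (BitString n × ε) ℂ}
    (hρ : IsSubnormalized ρ) : IsSubnormalized (zMeasure ρ) := by
  refine ⟨?_, by rw [trace_zMeasure]; exact hρ.2⟩
  rw [zMeasure_eq_cqState]
  exact posSemidef_cqState fun z => hρ.1.submatrix _

end ClassicalQuantum

section FrobeniusEnvelope

open scoped Matrix.Norms.Frobenius

variable {ι m n : Type*} [Fintype ι] [Fintype m] [Fintype n]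

lemma trace_mul_conjTranspose_self_eq_norm_sq {𝕜 : Type*} [RCLike 𝕜] (M : Matrix m n 𝕜) :
    (M * Mᴴ).trace = ((‖M‖ ^ 2 : ℝ) : 𝕜) := by
  rw [frobenius_norm_def, ← Real.sqrt_eq_rpow, Real.sq_sqrt (by positivity)]
  simp [trace, mul_apply, RCLike.mul_conj]

/-- The normalization of `∑ₓ Mₓ Mₓ† / ‖Mₓ‖₂`, with `‖·‖₂` the Hilbert–Schmidt norm. Up to scalars
it dominates `W W†` for every linear combination `W` of the `Mₓ`. It is a state unless all the
`Mₓ` vanish, in which case it is `0`. -/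
def frobeniusEnvelope (M : ι → Matrix m n ℂ) : Matrix m m ℂ :=
  (∑ x, ‖M x‖)⁻¹ • ∑ x, ‖M x‖⁻¹ • (M x * (M x)ᴴ)

lemma isNormalized_frobeniusEnvelope {M : ι → Matrix m n ℂ} (h : ∑ x, ‖M x‖ ≠ 0) :
    IsNormalized (frobeniusEnvelope M) := by
  constructor
  · exact (posSemidef_sum _ fun x _ => (posSemidef_self_mul_conjTranspose (M x)).smul
      (inv_nonneg.2 (norm_nonneg _))).smul (by positivity)
  · have term (x : ι) : (‖M x‖⁻¹ • (M x * (M x)ᴴ)).trace = ((‖M x‖ : ℝ) : ℂ) := by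
      rw [trace_smul, trace_mul_conjTranspose_self_eq_norm_sq, RCLike.real_smul_eq_coe_mul,
        ← RCLike.ofReal_mul, sq, ← mul_assoc, inv_mul_mul_self]
      rfl
    rw [frobeniusEnvelope, trace_smul, trace_sum]
    simp_rw [term]
    rw [Complex.real_smul]
    exact_mod_cast inv_mul_cancel₀ h

lemma sum_smul_mul_conjTranspose_le_frobeniusEnvelope (M : ι → Matrix m n ℂ) {c : ι → ℂ} {r : ℝ}
    (hc : ∀ x, ‖c x‖ ^ 2 ≤ r) :
    (∑ x, c x • M x) * (∑ x, c x • M x)ᴴ ≤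
      (r * (∑ x, ‖M x‖) ^ 2) • frobeniusEnvelope M := by
  have h_weight : ∑ x, ‖c x‖ ^ 2 * ‖M x‖ ≤ r * ∑ x, ‖M x‖ := by
    rw [Finset.mul_sum]
    gcongr with x
    exact hc x
  have h_nonneg : 0 ≤ ∑ x, ‖M x‖⁻¹ • (M x * (M x)ᴴ) := Finset.sum_nonneg fun x _ =>
    smul_nonneg (inv_nonneg.2 (norm_nonneg _)) (posSemidef_self_mul_conjTranspose _).nonneg
  calc (∑ x, c x • M x) * (∑ x, c x • M x)ᴴ
      ≤ (∑ x, ‖c x‖ ^ 2 * ‖M x‖) • ∑ x, ‖M x‖⁻¹ • (M x * (M x)ᴴ) :=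
        sum_smul_mul_conjTranspose_le_of_weight c M (fun x => norm_nonneg _)
          fun x => norm_eq_zero.1
    _ ≤ (r * ∑ x, ‖M x‖) • ∑ x, ‖M x‖⁻¹ • (M x * (M x)ᴴ) :=
        smul_le_smul_of_nonneg_right h_weight h_nonneg
    _ = (r * (∑ x, ‖M x‖) ^ 2) • frobeniusEnvelope M := by
        rw [frobeniusEnvelope, smul_smul, mul_assoc, sq, mul_self_mul_inv]

lemma exists_isNormalized_forall_sum_smul_mul_conjTranspose_le [Nonempty m] (M : ι → Matrix m n ℂ) :
    ∃ σ : Matrix m m ℂ, IsNormalized σ ∧ ∀ (c : ι → ℂ) (r : ℝ), (∀ x, ‖c x‖ ^ 2 ≤ r) →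
      (∑ x, c x • M x) * (∑ x, c x • M x)ᴴ ≤ (r * (∑ x, ‖M x‖) ^ 2) • σ := by
  by_cases h : ∑ x, ‖M x‖ = 0
  · obtain ⟨σ, hσ⟩ := exists_isNormalized (α := m)
    have hM (x : ι) : M x = 0 := norm_eq_zero.1
      ((Finset.sum_eq_zero_iff_of_nonneg fun _ _ => norm_nonneg _).1 h x (Finset.mem_univ x))
    exact ⟨σ, hσ, fun c r _ => by simp [hM]⟩
  · exact ⟨frobeniusEnvelope M, isNormalized_frobeniusEnvelope h, fun c r hc =>
      sum_smul_mul_conjTranspose_le_frobeniusEnvelope M hc⟩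

end FrobeniusEnvelope

section PhaseBasis

variable {n : ℕ}

/-- The nontrivial character `b ↦ (-1) ^ b` of `ZMod 2`. -/
def signChar : AddChar (ZMod 2) ℂ :=
  AddChar.zmodChar 2 (ζ := -1) (by norm_num)

lemma signChar_apply (b : ZMod 2) : signChar b = (-1) ^ b.val :=
  rfl

lemma phaseKet_apply (x z : BitString n) :
    phaseKet x z = (((2 : ℝ) ^ (-(n : ℝ) / 2) : ℝ) : ℂ) * signChar (x ⬝ᵥ z) :=
  rfl

lemma sum_signChar_dotProduct (w : BitString n) :
    ∑ x : BitString n, signChar (x ⬝ᵥ w) = if w = 0 then 2 ^ n else 0 := by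
  classical
  let ψ : AddChar (BitString n) ℂ := signChar.compAddMonoidHom
    (AddMonoidHom.mk' (· ⬝ᵥ w) fun x y => add_dotProduct x y w)
  have hψ : ψ = 0 ↔ w = 0 := by
    refine ⟨fun h => funext fun i => ?_, fun h => ?_⟩
    · have hi : signChar (w i) = 1 := by
        simpa [ψ] using AddChar.eq_zero_iff.1 h (Pi.single i 1)
      have h_bit : ∀ b : ZMod 2, b = 0 ∨ b = 1 := by decide
      refine (h_bit (w i)).resolve_right fun h1 => ?_
      norm_num [h1, signChar_apply, ZMod.val_one] at hi
    · ext x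
      simp [ψ, h]
  change ∑ x, ψ x = _
  simp [AddChar.sum_eq_ite, hψ, ZMod.card]

lemma two_rpow_half_sq (t : ℝ) : ((2 : ℝ) ^ (t / 2)) ^ 2 = 2 ^ t := by
  rw [← Real.rpow_mul_natCast zero_le_two]
  norm_num

lemma norm_phaseKet_sq (x z : BitString n) : ‖phaseKet x z‖ ^ 2 = (2 : ℝ) ^ (-(n : ℝ)) := by
  rw [phaseKet_apply, norm_mul, AddChar.norm_apply, mul_one, Complex.norm_real, Real.norm_eq_abs,
    sq_abs, two_rpow_half_sq]

lemma sum_phaseKet_mul_star_phaseKet (z z' : BitString n) :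
    ∑ x, phaseKet x z * star (phaseKet x z') = if z = z' then 1 else 0 := by
  have term (x : BitString n) : phaseKet x z * star (phaseKet x z') =
      (2 ^ n)⁻¹ * signChar (x ⬝ᵥ (z - z')) := by
    have h_scalar : (((2 : ℝ) ^ (-(n : ℝ) / 2) : ℝ) : ℂ) ^ 2 = (2 ^ n)⁻¹ := by
      rw [← Complex.ofReal_pow, two_rpow_half_sq, Real.rpow_neg zero_le_two,
        Real.rpow_natCast]
      norm_num
    rw [phaseKet_apply, phaseKet_apply, dotProduct_sub, sub_eq_add_neg, AddChar.map_add_eq_mul,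
      AddChar.map_neg_eq_conj, ← h_scalar, star_mul', Complex.star_def,
      Complex.conj_ofReal]
    ring
  simp_rw [term, ← Finset.mul_sum, sum_signChar_dotProduct, sub_eq_zero]
  split_ifs <;> simp

end PhaseBasis

section SemiPurification

open scoped Matrix.Norms.Frobenius

variable {α ε κ : Type*} {n : ℕ}

/-- The component `⟨z|Φ` of a vector in `H_A ⊗ H_E ⊗ H_Ā`, as an operator from `H_Ā` to `H_E`. -/
def component (Φ : (α × ε) × κ → ℂ) (z : α) : Matrix ε κ ℂ :=
  of fun e k => Φ ((z, e), k)

/-- The component `⟨x̃|Φ` of a vector in `H_A ⊗ H_E ⊗ H_Ā`, as an operator from `H_Ā` to `H_E`. -/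
def phaseComponent (Φ : (BitString n × ε) × κ → ℂ) (x : BitString n) : Matrix ε κ ℂ :=
  ∑ z, star (phaseKet x z) • component Φ z

lemma sum_phaseKet_smul_phaseComponent (Φ : (BitString n × ε) × κ → ℂ) (z : BitString n) :
    ∑ x, phaseKet x z • phaseComponent Φ x = component Φ z := by
  simp_rw [phaseComponent, Finset.smul_sum, smul_smul]
  rw [Finset.sum_comm]
  simp_rw [← Finset.sum_smul, sum_phaseKet_mul_star_phaseKet]
  simp

variable [Fintype κ]

lemma submatrix_ptrace_pureOp (Φ : (α × ε) × κ → ℂ) (z z' : α) :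
    (ptrace (pureOp Φ)).submatrix (Prod.mk z) (Prod.mk z') =
      component Φ z * (component Φ z')ᴴ := by
  ext e e'
  simp [ptrace, pureOp, component, vecMulVec_apply, mul_apply]

variable [Fintype ε]

lemma sqrt_phaseDist (Φ : (BitString n × ε) × κ → ℂ) (x : BitString n) :
    √(phaseDist Φ x) = ‖phaseComponent Φ x‖ := by
  have entry (z z' : BitString n) : ptrace (ptrace (pureOp Φ)) z z' =
      (component Φ z * (component Φ z')ᴴ).trace := by
    rw [← submatrix_ptrace_pureOp]
    rfl
  have h : star (phaseKet x) ⬝ᵥ (ptrace (ptrace (pureOp Φ))) *ᵥ phaseKet x =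
      (phaseComponent Φ x * (phaseComponent Φ x)ᴴ).trace := by
    simp only [phaseComponent, conjTranspose_sum, conjTranspose_smul, star_star, Matrix.sum_mul,
      Matrix.mul_sum, trace_sum, trace_smul, Matrix.smul_mul, Matrix.mul_smul, dotProduct, mulVec,
      entry, Pi.star_apply, smul_eq_mul, Finset.mul_sum]
    rw [Finset.sum_comm]
    simp only [mul_comm, mul_left_comm]
  rw [phaseDist, h, trace_mul_conjTranspose_self_eq_norm_sq]
  exact Real.sqrt_sq (norm_nonneg _)

variable [DecidableEq ε] {Φ : (BitString n × ε) × κ → ℂ}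
  {ρ : Matrix (BitString n × ε) (BitString n × ε) ℂ}

lemma zMeasure_ptrace_pureOp (Φ : (BitString n × ε) × κ → ℂ) :
    zMeasure (ptrace (pureOp Φ)) = cqState fun z => component Φ z * (component Φ z)ᴴ := by
  simp_rw [zMeasure_eq_cqState, submatrix_ptrace_pureOp]

lemma IsSemiPurification.isSubnormalized (h : IsSemiPurification Φ ρ) : IsSubnormalized ρ := by
  obtain ⟨hΦ, rfl⟩ := h
  exact hΦ.ptrace.zMeasure

variable [Nonempty ε] {H : ℝ}

lemma IsSemiPurification.le_condMinEntropy (h : IsSemiPurification Φ ρ)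
    (hX : AssumptionSMPECRenyi Φ H) : (((n : ℝ) - H : ℝ) : EReal) ≤ condMinEntropy ρ := by
  obtain ⟨-, rfl⟩ := h
  obtain ⟨σ, hσ, h_le⟩ :=
    exists_isNormalized_forall_sum_smul_mul_conjTranspose_le (phaseComponent Φ)
  have h_sq : (∑ x, ‖phaseComponent Φ x‖) ^ 2 ≤ (2 : ℝ) ^ H := by
    simpa only [sqrt_phaseDist] using renyiHalf_le_iff.1 hX
  rw [zMeasure_ptrace_pureOp]
  refine le_condMinEntropy_cqState hσ fun z => ?_
  calc component Φ z * (component Φ z)ᴴ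
      ≤ ((2 : ℝ) ^ (-(n : ℝ)) * (∑ x, ‖phaseComponent Φ x‖) ^ 2) • σ := by
        rw [← sum_phaseKet_smul_phaseComponent]
        exact h_le _ _ fun x => (norm_phaseKet_sq x z).le
    _ ≤ ((2 : ℝ) ^ (-(n : ℝ)) * 2 ^ H) • σ := by
        refine smul_le_smul_of_nonneg_right ?_ hσ.1.nonneg
        gcongr
    _ = (2 : ℝ) ^ (-((n : ℝ) - H)) • σ := by
        rw [← Real.rpow_add two_pos, neg_sub, neg_add_eq_sub]

lemma IsSemiPurification.assumptionSMLHL (h : IsSemiPurification Φ ρ)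
    (hX : AssumptionSMPECRenyi Φ H) {δ : ℝ} (hδ : 0 ≤ δ) :
    AssumptionSMLHL ρ δ ((n : ℝ) - H) :=
  (h.le_condMinEntropy hX).trans (condMinEntropy_le_smoothCondMinEntropy h.isSubnormalized hδ)

end SemiPurification

section ConditionalState

variable {A E B ι κ : Type*}

/-- The block `⟨e|ρ|e'⟩` of an operator on `H_A ⊗ H_E ⊗ H_B`, an operator on `H_A ⊗ H_B`. -/
def eveBlock (ρ : Matrix (A × E × B) (A × E × B) ℂ) (e e' : E) : Matrix (A × B) (A × B) ℂ :=
  ρ.submatrix (fun p => (p.1, e, p.2)) (fun p => (p.1, e', p.2))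

variable [Fintype A] [Fintype B]

/-- The unnormalized state of `E` after the effect `P` has been observed on `A`,
`Tr_{AB} ((P ⊗ 1) ρ)`. -/
def conditionalState (P : Matrix A A ℂ) (ρ : Matrix (A × E × B) (A × E × B) ℂ) : Matrix E E ℂ :=
  of fun e e' => (P * ptrace (eveBlock ρ e e')).trace

lemma sum_conditionalState [Fintype ι] (P : ι → Matrix A A ℂ)
    (ρ : Matrix (A × E × B) (A × E × B) ℂ) :
    ∑ i, conditionalState (P i) ρ = conditionalState (∑ i, P i) ρ := by
  ext e e'
  simp [conditionalState, Matrix.sum_apply, Matrix.sum_mul, trace_sum]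

variable [Fintype E]

lemma trace_conditionalState_one [DecidableEq A] (ρ : Matrix (A × E × B) (A × E × B) ℂ) :
    (conditionalState 1 ρ).trace = ρ.trace := by
  simp only [conditionalState, Matrix.one_mul, trace_ptrace]
  simp only [trace, diag_apply, of_apply, eveBlock, submatrix_apply, Fintype.sum_prod_type]
  exact Finset.sum_comm

variable [DecidableEq E]

lemma kronecker_one_kronecker_mul_submatrix (F : Matrix A A ℂ) (G : Matrix B B ℂ)
    (M : Matrix (A × E × B) ι ℂ) (e : E) (g : κ → ι) :
    ((F ⊗ₖ ((1 : Matrix E E ℂ) ⊗ₖ G)) * M).submatrix (fun p : A × B => (p.1, e, p.2)) g =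
      (F ⊗ₖ G) * M.submatrix (fun p : A × B => (p.1, e, p.2)) g := by
  ext p k
  simp only [submatrix_apply, mul_apply, Fintype.sum_prod_type, kroneckerMap_apply]
  refine Finset.sum_congr rfl fun a _ => ?_
  rw [Finset.sum_eq_single e]
  · simp
  · intro f _ hf
    simp [one_apply_ne (Ne.symm hf)]
  · simp

lemma mul_conjTranspose_kronecker_one_kronecker_submatrix (F : Matrix A A ℂ) (G : Matrix B B ℂ)
    (M : Matrix ι (A × E × B) ℂ) (e : E) (g : κ → ι) :
    (M * (F ⊗ₖ ((1 : Matrix E E ℂ) ⊗ₖ G))ᴴ).submatrix g (fun p : A × B => (p.1, e, p.2)) =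
      M.submatrix g (fun p : A × B => (p.1, e, p.2)) * (F ⊗ₖ G)ᴴ := by
  have h := congrArg conjTranspose (kronecker_one_kronecker_mul_submatrix F G Mᴴ e g)
  simpa only [conjTranspose_submatrix, conjTranspose_mul, conjTranspose_conjTranspose] using h

lemma trace_eveBlock_conj (F : Matrix A A ℂ) (G : Matrix B B ℂ)
    (ρ : Matrix (A × E × B) (A × E × B) ℂ) (e e' : E) :
    (eveBlock ((F ⊗ₖ ((1 : Matrix E E ℂ) ⊗ₖ G)) * ρ * (F ⊗ₖ ((1 : Matrix E E ℂ) ⊗ₖ G))ᴴ)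
      e e').trace = (((Fᴴ * F) ⊗ₖ (Gᴴ * G)) * eveBlock ρ e e').trace := by
  rw [eveBlock, Matrix.mul_assoc, kronecker_one_kronecker_mul_submatrix,
    mul_conjTranspose_kronecker_one_kronecker_submatrix, ← Matrix.mul_assoc, trace_mul_cycle,
    conjTranspose_kronecker, ← mul_kronecker_mul, eveBlock]

lemma sum_trace_eveBlock_conj [DecidableEq B] [Fintype ι] (F : Matrix A A ℂ)
    {G : ι → Matrix B B ℂ} (hG : ∑ b, (G b)ᴴ * G b = 1) (ρ : Matrix (A × E × B) (A × E × B) ℂ)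
    (e e' : E) :
    ∑ b, (eveBlock ((F ⊗ₖ ((1 : Matrix E E ℂ) ⊗ₖ G b)) * ρ *
      (F ⊗ₖ ((1 : Matrix E E ℂ) ⊗ₖ G b))ᴴ) e e').trace = conditionalState (Fᴴ * F) ρ e e' := by
  have h_sum : ∑ b, (Fᴴ * F) ⊗ₖ ((G b)ᴴ * G b) = (Fᴴ * F) ⊗ₖ (1 : Matrix B B ℂ) := by
    rw [← hG]
    exact (map_sum (kroneckerBilinear (R := ℂ) (Fᴴ * F)) _ _).symm
  simp_rw [trace_eveBlock_conj, ← trace_sum, ← Matrix.sum_mul, h_sum, trace_kronecker_one_mul]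
  rfl

end ConditionalState

section Schemes

variable {n : ℕ} {A E B I C R : Type*} [Fintype A] [DecidableEq A] [Fintype E] [DecidableEq E]
  [Fintype B] [DecidableEq B] [Fintype I] [Fintype C] [DecidableEq C] [Fintype R] [DecidableEq R]

lemma ActualScheme.nonempty (S : ActualScheme n A E B I) : Nonempty E := by
  by_contra h
  rw [not_nonempty_iff] at h
  simpa [trace] using S.init_normalized.2

lemma ActualScheme.trace_sample_init_le (S : ActualScheme n A E B I) :
    (S.sample S.init).trace.re ≤ 1 := by
  have h_nonneg (i : I) : 0 ≤ (S.smp i * S.init * (S.smp i)ᴴ).trace.re :=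
    (Complex.le_def.1 (S.init_normalized.1.mul_mul_conjTranspose_same (S.smp i)).trace_nonneg).1
  have h_total : ∑ i, (S.smp i * S.init * (S.smp i)ᴴ).trace = 1 := by
    simp_rw [Matrix.trace_mul_cycle (S.smp _)]
    rw [← trace_sum, ← Finset.sum_mul, S.smp_complete, Matrix.one_mul, S.init_normalized.2]
  calc (S.sample S.init).trace.re = ∑ i ∈ S.pass, (S.smp i * S.init * (S.smp i)ᴴ).trace.re := by
        rw [ActualScheme.sample, trace_sum, Complex.re_sum]
    _ ≤ ∑ i, (S.smp i * S.init * (S.smp i)ᴴ).trace.re :=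
        Finset.sum_le_sum_of_subset_of_nonneg (Finset.subset_univ _) fun i _ _ => h_nonneg i
    _ = 1 := by rw [← Complex.re_sum, h_total, Complex.one_re]

lemma ActualScheme.siftedAE_eq_cqState (S : ActualScheme n A E B I) :
    S.siftedAE = cqState fun z =>
      conditionalState ((S.sifA z)ᴴ * S.sifA z) (S.sample S.init) := by
  ext ⟨z, e⟩ ⟨z', e'⟩
  rw [cqState_apply]
  simp_rw [← sum_trace_eveBlock_conj _ S.sifB_complete]
  by_cases h : z = z'
  · subst h
    simp [ActualScheme.siftedAE, ActualScheme.sifted, Matrix.sum_apply, single_apply, trace,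
      eveBlock, Fintype.sum_prod_type]
  · have h_single (y : BitString n) : single y y (1 : ℂ) z z' = 0 :=
      single_apply_of_ne _ _ _ _ _ (by rintro ⟨rfl, rfl⟩; exact h rfl)
    simp [ActualScheme.siftedAE, ActualScheme.sifted, Matrix.sum_apply, h, h_single]

lemma ActualScheme.trace_siftedAE (S : ActualScheme n A E B I) :
    S.siftedAE.trace = (S.sample S.init).trace := by
  rw [S.siftedAE_eq_cqState, trace_cqState, ← trace_sum, sum_conditionalState, S.sifA_complete,
    trace_conditionalState_one]

variable {S : ActualScheme n A E B I} (V : VirtualScheme S C R)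

lemma VirtualScheme.ptrace_ptrace_pureOp_smpState :
    ptrace (ptrace (pureOp V.smpState)) = S.sample S.init := by
  set Q := ((1 : Matrix (A × E × B) (A × E × B) ℂ) ⊗ₖ V.pSmp) * V.uSmp with hQ
  have h_state : (of fun y c => V.smpState (y, c)) =
      Q.submatrix id (fun x => (x, V.blank)) * (of fun x c => V.ini (x, c)) :=
    rfl
  rw [← V.smp_eq, ← V.ini_purifies, ptrace_pureOp V.smpState, ptrace_pureOp V.ini,
    mul_kronecker_single_mul_conjTranspose, ← hQ, h_state, conjTranspose_mul]
  simp only [Matrix.mul_assoc]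

/-- The component of the state after the sample measurement along the basis vector `e` of Eve's
space, a vector of Alice's ancilla. -/
def VirtualScheme.smpComponent (e : E) : A × B × R × C → ℂ :=
  fun k => V.smpState (((k.1, e, k.2.1), k.2.2.1), k.2.2.2)

lemma VirtualScheme.ptrace_vecMulVec_smpComponent (e e' : E) :
    ptrace (vecMulVec (V.smpComponent e) (star (V.smpComponent e'))) =
      ptrace (eveBlock (S.sample S.init) e e') := by
  rw [← V.ptrace_ptrace_pureOp_smpState]
  ext a a'
  simp [ptrace, pureOp, eveBlock, vecMulVec_apply, VirtualScheme.smpComponent,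
    Fintype.sum_prod_type]

lemma VirtualScheme.component_preState_mul_conjTranspose (z : BitString n) :
    component V.preState z * (component V.preState z)ᴴ =
      conditionalState ((S.sifA z)ᴴ * S.sifA z) (S.sample S.init) := by
  set T := V.uSif.submatrix (fun k => (z, k)) (fun k => (0, k)) with hT
  ext e e'
  calc (component V.preState z * (component V.preState z)ᴴ) e e'
      = (T *ᵥ V.smpComponent e) ⬝ᵥ star (T *ᵥ V.smpComponent e') := rfl
    _ = (T * vecMulVec (V.smpComponent e) (star (V.smpComponent e')) * Tᴴ).trace := by
        rw [mul_vecMulVec, vecMulVec_mul, trace_vecMulVec, star_mulVec]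
    _ = (Tᴴ * T * vecMulVec (V.smpComponent e) (star (V.smpComponent e'))).trace :=
        trace_mul_cycle _ _ _
    _ = ((S.sifA z)ᴴ * S.sifA z *
          ptrace (vecMulVec (V.smpComponent e) (star (V.smpComponent e')))).trace := by
        rw [hT, V.sif_eq, trace_kronecker_one_mul]
    _ = conditionalState ((S.sifA z)ᴴ * S.sifA z) (S.sample S.init) e e' := by
        rw [V.ptrace_vecMulVec_smpComponent]
        rfl

lemma VirtualScheme.isSemiPurification_preState : IsSemiPurification V.preState S.siftedAE := by
  have h_measured : zMeasure (ptrace (pureOp V.preState)) = S.siftedAE := by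
    simp_rw [zMeasure_ptrace_pureOp, V.component_preState_mul_conjTranspose, S.siftedAE_eq_cqState]
  refine ⟨⟨posSemidef_vecMulVec_self_star _, ?_⟩, h_measured⟩
  rw [← trace_ptrace, ← trace_zMeasure, h_measured, S.trace_siftedAE]
  exact S.trace_sample_init_le

end Schemes

end QKD

end

theorem mainTheorem6 (n : ℕ) (Hth : ℝ) :
    -- every semi-purification of every sub-normalized classical-quantum state
    (∀ {E K : Type*} [Fintype E] [DecidableEq E] [Nonempty E] [Fintype K]
        (ρ : Matrix (QKD.BitString n × E) (QKD.BitString n × E) ℂ)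
        (Φ : (QKD.BitString n × E) × K → ℂ),
      QKD.IsSemiPurification Φ ρ → QKD.AssumptionSMPECRenyi Φ Hth →
        (((n : ℝ) - Hth : ℝ) : EReal) ≤ QKD.condMinEntropy ρ ∧
          QKD.AssumptionSMLHL ρ 0 ((n : ℝ) - Hth)) ∧
    -- the sifted-key state of every scheme, and the state of every associated virtual scheme
    (∀ {A E B I C R : Type*} [Fintype A] [DecidableEq A] [Fintype E] [DecidableEq E]
        [Fintype B] [DecidableEq B] [Fintype I] [Fintype C] [DecidableEq C]
        [Fintype R] [DecidableEq R]
        (S : QKD.ActualScheme n A E B I) (V : QKD.VirtualScheme S C R),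
      QKD.AssumptionSMPECRenyi V.preState Hth →
        (((n : ℝ) - Hth : ℝ) : EReal) ≤ QKD.condMinEntropy S.siftedAE ∧
          QKD.AssumptionSMLHL S.siftedAE 0 ((n : ℝ) - Hth)) := by
  refine ⟨fun ρ Φ hΦ hX => ⟨hΦ.le_condMinEntropy hX, hΦ.assumptionSMLHL hX le_rfl⟩,
    fun S V hX => ?_⟩
  have := S.nonempty
  exact ⟨V.isSemiPurification_preState.le_condMinEntropy hX,
    V.isSemiPurification_preState.assumptionSMLHL hX le_rfl⟩
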